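/- Let $n\ge 1$, let $\Omega\subset\mathbb{R}^n$ be a bounded open set, and let $F:\partial\Omega\to\mathbb{R}$ be Lipschitz, with least Lipschitz constant $$L_F(\partial\Omega)=\min\{c\ge 0:\ |F(x)-F(y)|\le c\,|x-y|\ \text{ for all } x,y\in\partial\Omega\}.$$ For $\lambda\ge 0$ put $$\overline{u}(x)=\inf_{z\in\partial\Omega}\big(F(z)+\lambda|x-z|\big),\qquad \underline{u}(x)=\sup_{z\in\partial\Omega}\big(F(z)-\lambda|x-z|\big)$$ (McShane's and Whitney's extensions), and let $\Delta_\infty\phi=\langle D^2\phi\,\nabla\phi,\nabla\phi\rangle$. A function $u$ is a viscosity subsolution (supersolution) of an equation $G(\nabla u,D^2u)=0$ in $\Omega$ if it is upper (lower) semicontinuous in $\Omega$ and, whenever $\phi\in C^2(\Omega)$ touches $u$ at $\hat x\in\Omega$ from above (from below) in a neighborhood of $\hat x$, one has $G(\nabla\phi(\hat x),D^2\phi(\hat x))\le 0$ ($\ge 0$); it is a viscosity solution if it is both. (i) If $\lambda\ge L_F(\partial\Omega)$, then $\overline{u}$ is, among functions in $C(\overline\Omega)$, the unique viscosity solution of $$\min\{|\nabla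 u|-\lambda,\,-\Delta_\infty u\}=0\ \text{ in }\Omega,\qquad u=F\ \text{ on }\partial\Omega,$$ and $\underline{u}$ is, among functions in $C(\overline\Omega)$, the unique viscosity solution of $$\max\{\lambda-|\nabla u|,\,-\Delta_\infty u\}=0\ \text{ in }\Omega,\qquad u=F\ \text{ on }\partial\Omega.$$ (ii) If $0\le\lambda<L_F(\partial\Omega)$, then $\overline{u}$ and $\underline{u}$ are still viscosity solutions in $\Omega$ of $\min\{|\nabla u|-\lambda,-\Delta_\infty u\}=0$ and $\max\{\lambda-|\nabla u|,-\Delta_\infty u\}=0$, respectively, but neither attains the boundary values: there are points $z,z'\in\partial\Omega$ with $\overline{u}(z)\ne F(z)$ and $\underline{u}(z')\ne F(z')$. -/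

import Mathlib

open Topology Set

noncomputable section

/-- The Euclidean space `ℝⁿ`. -/
abbrev Euc (n : ℕ) : Type := EuclideanSpace ℝ (Fin n)

/-- The infinity Laplacian `Δ_∞ φ (x) = ⟨D²φ(x) ∇φ(x), ∇φ(x)⟩`. -/
def infLaplacian {n : ℕ} (φ : Euc n → ℝ) (x : Euc n) : ℝ :=
  fderiv ℝ (fderiv ℝ φ) x (gradient φ x) (gradient φ x)

/-- The operator `min {|∇φ| - lam, -Δ_∞ φ}`. -/
def jensenMin {n : ℕ} (lam : ℝ) (φ : Euc n → ℝ) (x : Euc n) : ℝ :=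
  min (‖gradient φ x‖ - lam) (-infLaplacian φ x)

/-- The operator `max {lam - |∇φ|, -Δ_∞ φ}`. -/
def jensenMax {n : ℕ} (lam : ℝ) (φ : Euc n → ℝ) (x : Euc n) : ℝ :=
  max (lam - ‖gradient φ x‖) (-infLaplacian φ x)

/-- `u` is a viscosity subsolution of `G = 0` in `Ω`: it is upper semicontinuous in `Ω`, and
`G φ x₀ ≤ 0` whenever `φ ∈ C²(Ω)` touches `u` at `x₀ ∈ Ω` from above near `x₀`. -/
def IsViscositySubsolution {n : ℕ} (G : (Euc n → ℝ) → Euc n → ℝ) (Ω : Set (Euc n))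
    (u : Euc n → ℝ) : Prop :=
  UpperSemicontinuousOn u Ω ∧
    ∀ φ : Euc n → ℝ, ContDiffOn ℝ 2 φ Ω → ∀ x₀ ∈ Ω, φ x₀ = u x₀ →
      (∀ᶠ x in 𝓝 x₀, u x ≤ φ x) → G φ x₀ ≤ 0

/-- `u` is a viscosity supersolution of `G = 0` in `Ω`: it is lower semicontinuous in `Ω`, and
`0 ≤ G φ x₀` whenever `φ ∈ C²(Ω)` touches `u` at `x₀ ∈ Ω` from below near `x₀`. -/
def IsViscositySupersolution {n : ℕ} (G : (Euc n → ℝ) → Euc n → ℝ) (Ω : Set (Euc n))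
    (u : Euc n → ℝ) : Prop :=
  LowerSemicontinuousOn u Ω ∧
    ∀ φ : Euc n → ℝ, ContDiffOn ℝ 2 φ Ω → ∀ x₀ ∈ Ω, φ x₀ = u x₀ →
      (∀ᶠ x in 𝓝 x₀, φ x ≤ u x) → 0 ≤ G φ x₀

/-- `u` is a viscosity solution of `G = 0` in `Ω`. -/
def IsViscositySolution {n : ℕ} (G : (Euc n → ℝ) → Euc n → ℝ) (Ω : Set (Euc n))
    (u : Euc n → ℝ) : Prop :=
  IsViscositySubsolution G Ω u ∧ IsViscositySupersolution G Ω u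

/-- `u ∈ C(closure Ω)` is a viscosity solution of the Dirichlet problem `G = 0` in `Ω`,
`u = F` on the boundary of `Ω`. Only the values of `u` on `closure Ω` matter. -/
def IsDirichletSolution {n : ℕ} (G : (Euc n → ℝ) → Euc n → ℝ) (Ω : Set (Euc n))
    (F : frontier Ω → ℝ) (u : Euc n → ℝ) : Prop :=
  ContinuousOn u (closure Ω) ∧ IsViscositySolution G Ω u ∧ ∀ z : frontier Ω, u z = F z

/-- `u` is the unique viscosity solution, as a function on `closure Ω`, of the Dirichlet problem
`G = 0` in `Ω`, `u = F` on the boundary of `Ω`. -/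
def IsUniqueDirichletSolution {n : ℕ} (G : (Euc n → ℝ) → Euc n → ℝ) (Ω : Set (Euc n))
    (F : frontier Ω → ℝ) (u : Euc n → ℝ) : Prop :=
  IsDirichletSolution G Ω F u ∧
    ∀ v : Euc n → ℝ, IsDirichletSolution G Ω F v → EqOn v u (closure Ω)

/-- The least Lipschitz constant `L_g(K)`: the smallest `c ≥ 0` with `|g x - g y| ≤ c |x - y|`
for all `x, y ∈ K`. It is used for Lipschitz functions only. -/
def leastLipschitzConst {n : ℕ} (K : Set (Euc n)) (g : K → ℝ) : ℝ :=
  sInf {c : ℝ | 0 ≤ c ∧ ∀ x y : K, |g x - g y| ≤ c * ‖(x : Euc n) - (y : Euc n)‖}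

/-- McShane's extension `x ↦ inf_{z ∈ ∂Ω} (F(z) + lam |x - z|)`. -/
def mcShane {n : ℕ} (Ω : Set (Euc n)) (F : frontier Ω → ℝ) (lam : ℝ) (x : Euc n) : ℝ :=
  ⨅ z : frontier Ω, (F z + lam * ‖x - (z : Euc n)‖)

/-- Whitney's extension `x ↦ sup_{z ∈ ∂Ω} (F(z) - lam |x - z|)`. -/
def whitney {n : ℕ} (Ω : Set (Euc n)) (F : frontier Ω → ℝ) (lam : ℝ) (x : Euc n) : ℝ :=
  ⨆ z : frontier Ω, (F z - lam * ‖x - (z : Euc n)‖)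

end

/-! Replacing `u`, `F` by their negatives swaps the two equations and the two extensions, so it
suffices to treat `mcShane` and `jensenMin`. McShane's extension is an infimum of cones of slope
`lam` with vertices outside Ω. It is `lam`-Lipschitz, so test functions from above have gradient at
most `lam`. At each point of Ω the infimum is attained by a cone smooth there, and a test function
from below lies under that cone, so its gradient has norm `lam` and `Δ_∞ φ ≤ 0`. This works for
every `lam ≥ 0`; the boundary values are attained exactly when `F` is `lam`-Lipschitz. For
uniqueness, `le_cone` perturbs a cone to a strict supersolution and puts any solution below every
cone defining `mcShane`. Conversely, `exists_cone_le` slides a smoothed cone of slope below `lam`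
under the solution: contact in Ω would violate `|∇u| ≥ lam`, so contact occurs on the boundary. -/

/-! ### Derivative tests at a touching point -/

section Calculus

variable {n : ℕ} {φ : Euc n → ℝ} {x₀ : Euc n}

lemma hasDerivAt_comp_line {x e : Euc n} {t : ℝ} (h : DifferentiableAt ℝ φ (x + t • e)) :
    HasDerivAt (fun s : ℝ => φ (x + s • e)) (fderiv ℝ φ (x + t • e) e) t := by
  have h1 : HasDerivAt (fun s : ℝ => x + s • e) e t := by
    simpa using ((hasDerivAt_id t).smul_const e).const_add x
  exact h.hasFDerivAt.comp_hasDerivAt t h1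

lemma tendsto_line (x e : Euc n) : Filter.Tendsto (fun t : ℝ => x + t • e) (𝓝 0) (𝓝 x) := by
  have : Continuous (fun t : ℝ => x + t • e) := by fun_prop
  simpa using this.tendsto 0

/-- The second order necessary condition for a local maximum. -/
lemma IsLocalMax.second_deriv_nonpos {k k' : ℝ → ℝ} {x c : ℝ} (hmax : IsLocalMax k x)
    (hk : ∀ᶠ t in 𝓝 x, HasDerivAt k (k' t) t) (hk' : HasDerivAt k' c x) : c ≤ 0 := by
  by_contra! hc
  have hd : deriv k =ᶠ[𝓝 x] k' := hk.mono fun t ht => ht.deriv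
  have hdd : deriv (deriv k) x = c := by rw [hd.deriv_eq, hk'.deriv]
  -- A positive second derivative would make `x` also a local minimum, so `k` would be locally
  -- constant.
  have hmin : IsLocalMin k x := isLocalMin_of_deriv_deriv_pos (by rw [hdd]; exact hc)
    hmax.deriv_eq_zero hk.self_of_nhds.continuousAt
  have hconst : k =ᶠ[𝓝 x] fun _ => k x := by
    filter_upwards [hmax, hmin] with t h1 h2 using le_antisymm h1 h2
  have h0 : deriv (deriv k) x = 0 := by
    rw [hconst.deriv.deriv_eq]
    simp
  linarith

/-- A quadratic upper bound along a line through `x₀` controls the first two derivatives. -/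
lemma fderiv_of_le_quadratic_on_line {e : Euc n} {a b : ℝ} (hφ : ContDiffAt ℝ 2 φ x₀)
    (h : ∀ᶠ t : ℝ in 𝓝 0, φ (x₀ + t • e) ≤ φ x₀ + a * t + b * t ^ 2) :
    fderiv ℝ φ x₀ e = a ∧ fderiv ℝ (fderiv ℝ φ) x₀ e e ≤ 2 * b := by
  have hdiff : ∀ᶠ x in 𝓝 x₀, DifferentiableAt ℝ φ x :=
    (hφ.eventually (by simp)).mono fun x hx => hx.differentiableAt (by simp)
  have hdφ : DifferentiableAt ℝ (fderiv ℝ φ) x₀ :=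
    (hφ.fderiv_right (m := 1) (by norm_num)).differentiableAt (by simp)
  have hk : ∀ᶠ t : ℝ in 𝓝 0, HasDerivAt (fun s : ℝ => φ (x₀ + s • e) - a * s - b * s ^ 2)
      (fderiv ℝ φ (x₀ + t • e) e - a - b * (2 * t)) t := by
    filter_upwards [(tendsto_line x₀ e).eventually hdiff] with t ht
    have h1 : HasDerivAt (fun s : ℝ => a * s) a t := by
      simpa using (hasDerivAt_id t).const_mul a
    have h2 : HasDerivAt (fun s : ℝ => b * s ^ 2) (b * (2 * t)) t := by
      simpa using (hasDerivAt_pow 2 t).const_mul b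
    exact ((hasDerivAt_comp_line ht).sub h1).sub h2
  have hk' : HasDerivAt (fun t : ℝ => fderiv ℝ φ (x₀ + t • e) e - a - b * (2 * t))
      (fderiv ℝ (fderiv ℝ φ) x₀ e e - b * 2) 0 := by
    have h1 : HasDerivAt (fun s : ℝ => x₀ + s • e) e 0 := by
      simpa using ((hasDerivAt_id (0 : ℝ)).smul_const e).const_add x₀
    have h2 : HasDerivAt (fun s : ℝ => fderiv ℝ φ (x₀ + s • e))
        (fderiv ℝ (fderiv ℝ φ) x₀ e) 0 := by
      have : HasFDerivAt (fderiv ℝ φ) (fderiv ℝ (fderiv ℝ φ) x₀) (x₀ + (0 : ℝ) • e) := by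
        simpa using hdφ.hasFDerivAt
      exact this.comp_hasDerivAt 0 h1
    have h3 : HasDerivAt (fun s : ℝ => fderiv ℝ φ (x₀ + s • e) e)
        (fderiv ℝ (fderiv ℝ φ) x₀ e e) 0 := by
      simpa using h2.clm_apply (hasDerivAt_const (0 : ℝ) e)
    have h4 : HasDerivAt (fun t : ℝ => b * (2 * t)) (b * 2) 0 := by
      simpa using ((hasDerivAt_id (0 : ℝ)).const_mul 2).const_mul b
    exact (h3.sub_const a).sub h4
  have hmax : IsLocalMax (fun s : ℝ => φ (x₀ + s • e) - a * s - b * s ^ 2) 0 := by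
    filter_upwards [h] with t ht
    simp
    linarith
  constructor
  · have := hmax.hasDerivAt_eq_zero hk.self_of_nhds
    simp at this
    linarith
  · have := hmax.second_deriv_nonpos hk hk'
    linarith

/-- Moving in the direction of the gradient `G` itself, the difference quotients tend to `‖G‖ ^ 2`
and are at most `a * ‖G‖`. -/
lemma norm_gradient_le_of_eventually_le {a : ℝ} (hφ : DifferentiableAt ℝ φ x₀)
    (h : ∀ᶠ x in 𝓝 x₀, φ x ≤ φ x₀ + a * ‖x - x₀‖) (ha : 0 ≤ a) : ‖gradient φ x₀‖ ≤ a := by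
  set G := gradient φ x₀ with hG
  have hd : HasDerivAt (fun s : ℝ => φ (x₀ + s • G)) (‖G‖ ^ 2) 0 := by
    have := hasDerivAt_comp_line (φ := φ) (x := x₀) (e := G) (t := 0) (by simpa using hφ)
    rwa [zero_smul, add_zero, ← inner_gradient_left, ← hG,
      real_inner_self_eq_norm_sq] at this
  have hle : ‖G‖ ^ 2 ≤ a * ‖G‖ := by
    have hlim := hd.tendsto_slope.mono_left (nhdsGT_le_nhdsNE 0)
    refine le_of_tendsto hlim ?_
    filter_upwards [((tendsto_line x₀ G).eventually h).filter_mono nhdsWithin_le_nhds,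
      self_mem_nhdsWithin (s := Ioi (0 : ℝ))] with t ht h0
    have h0' : (0 : ℝ) < t := h0
    rw [add_sub_cancel_left, norm_smul, Real.norm_of_nonneg h0'.le] at ht
    rw [slope_def_field, sub_zero, div_le_iff₀ h0', zero_smul, add_zero]
    linarith
  rcases (norm_nonneg G).eq_or_lt with h0 | h0
  · linarith
  · exact le_of_mul_le_mul_right (by linarith) h0

/-- A radial function touching `φ` from above at `x₀` controls the gradient and the infinity
Laplacian of `φ` at `x₀`. -/
lemma gradient_infLaplacian_of_le_radial {z : Euc n} {a b : ℝ} (hφ : ContDiffAt ℝ 2 φ x₀)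
    (hz : x₀ ≠ z) (ha : 0 ≤ a) (hb : b ≤ 0)
    (h : ∀ᶠ x in 𝓝 x₀, φ x ≤ φ x₀ + a * (‖x - z‖ - ‖x₀ - z‖) + b * (‖x - z‖ - ‖x₀ - z‖) ^ 2) :
    ‖gradient φ x₀‖ = a ∧ infLaplacian φ x₀ ≤ 2 * b * a ^ 2 := by
  set r := ‖x₀ - z‖ with hr
  have hr0 : 0 < r := norm_pos_iff.2 (sub_ne_zero.2 hz)
  set e := r⁻¹ • (x₀ - z) with he
  have hre : r • e = x₀ - z := by rw [he, smul_smul, mul_inv_cancel₀ hr0.ne', one_smul]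
  have hen : ‖e‖ = 1 := by
    rw [he, norm_smul, norm_inv, Real.norm_of_nonneg hr0.le, ← hr, inv_mul_cancel₀ hr0.ne']
  have hline : ∀ᶠ t : ℝ in 𝓝 0, φ (x₀ + t • e) ≤ φ x₀ + a * t + b * t ^ 2 := by
    filter_upwards [(tendsto_line x₀ e).eventually h, lt_mem_nhds (neg_lt_zero.2 hr0)] with t ht h0
    have : ‖x₀ + t • e - z‖ = r + t := by
      rw [show x₀ + t • e - z = (r + t) • e by rw [add_smul, hre]; abel, norm_smul, hen, mul_one,
        Real.norm_of_nonneg (by linarith)]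
    rwa [this, add_sub_cancel_left] at ht
  obtain ⟨h1, h2⟩ := fderiv_of_le_quadratic_on_line hφ hline
  have h3 : ‖gradient φ x₀‖ ≤ a := by
    refine norm_gradient_le_of_eventually_le (hφ.differentiableAt (by simp)) ?_ ha
    filter_upwards [h] with x hx
    have hn : ‖x - z‖ - r ≤ ‖x - x₀‖ := by
      have := norm_sub_norm_le (x - z) (x₀ - z)
      rwa [sub_sub_sub_cancel_right] at this
    nlinarith [mul_le_mul_of_nonneg_left hn ha,
      mul_nonneg (neg_nonneg.2 hb) (sq_nonneg (‖x - z‖ - r))]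
  rw [← inner_gradient_left] at h1
  -- Equality case of Cauchy–Schwarz: the gradient has norm at most `a` and component `a` along the
  -- unit vector `e`.
  have h4 : gradient φ x₀ = a • e := by
    rw [← sub_eq_zero, ← norm_eq_zero, ← sq_eq_zero_iff]
    have h5 := norm_sub_sq_real (gradient φ x₀) (a • e)
    rw [inner_smul_right, h1, norm_smul, hen, Real.norm_of_nonneg ha] at h5
    nlinarith [norm_nonneg (gradient φ x₀), sq_nonneg ‖gradient φ x₀ - a • e‖]
  constructor
  · rw [h4, norm_smul, hen, Real.norm_of_nonneg ha, mul_one]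
  · rw [infLaplacian, h4]
    simp only [map_smul, smul_apply, smul_eq_mul]
    nlinarith [mul_le_mul_of_nonneg_left h2 (mul_self_nonneg a)]

lemma gradient_neg_fun : gradient (fun x => -φ x) x₀ = -gradient φ x₀ := by
  simp [gradient, fderiv_fun_neg]

lemma infLaplacian_neg_fun : infLaplacian (fun x => -φ x) x₀ = -infLaplacian φ x₀ := by
  have : fderiv ℝ (fun x => -φ x) = fun x => -fderiv ℝ φ x := by
    ext1 x
    exact fderiv_fun_neg
  simp [infLaplacian, gradient_neg_fun, this, fderiv_fun_neg]

lemma jensenMin_neg_fun (lam : ℝ) : jensenMin lam (fun x => -φ x) x₀ = -jensenMax lam φ x₀ := by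
  rw [jensenMin, jensenMax, gradient_neg_fun, infLaplacian_neg_fun, norm_neg, neg_neg,
    ← min_neg_neg]
  simp

end Calculus

/-! ### Sign change -/

section Symmetry

variable {n : ℕ} {Ω : Set (Euc n)} {lam : ℝ} {u : Euc n → ℝ}

lemma IsViscositySolution.jensenMax_of_neg
    (h : IsViscositySolution (jensenMin lam) Ω (fun x => -u x)) :
    IsViscositySolution (jensenMax lam) Ω u := by
  obtain ⟨⟨husc, hsub⟩, hlsc, hsup⟩ := h
  refine ⟨⟨?_, fun φ hφ x₀ hx h0 hle => ?_⟩, ?_, fun φ hφ x₀ hx h0 hle => ?_⟩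
  · intro x hx y hy
    filter_upwards [hlsc x hx (-y) (neg_lt_neg hy)] with t ht using neg_lt_neg_iff.1 ht
  · have := hsup (fun x => -φ x) hφ.neg x₀ hx (by rw [h0]) (hle.mono fun x h => neg_le_neg h)
    rw [jensenMin_neg_fun] at this
    linarith
  · intro x hx y hy
    filter_upwards [husc x hx (-y) (neg_lt_neg hy)] with t ht using neg_lt_neg_iff.1 ht
  · have := hsub (fun x => -φ x) hφ.neg x₀ hx (by rw [h0]) (hle.mono fun x h => neg_le_neg h)
    rw [jensenMin_neg_fun] at this
    linarith

lemma IsViscositySolution.jensenMin_neg (h : IsViscositySolution (jensenMax lam) Ω u) :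
    IsViscositySolution (jensenMin lam) Ω (fun x => -u x) := by
  obtain ⟨⟨husc, hsub⟩, hlsc, hsup⟩ := h
  have key : ∀ (φ : Euc n → ℝ) x, jensenMin lam φ x = -jensenMax lam (fun y => -φ y) x := by
    intro φ x
    simpa using jensenMin_neg_fun (φ := fun y => -φ y) (x₀ := x) lam
  refine ⟨⟨?_, fun φ hφ x₀ hx h0 hle => ?_⟩, ?_, fun φ hφ x₀ hx h0 hle => ?_⟩
  · intro x hx y hy
    filter_upwards [hlsc x hx (-y) (neg_lt.1 hy)] with t ht using neg_lt.1 ht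
  · have := hsup (fun x => -φ x) hφ.neg x₀ hx (by rw [h0, neg_neg])
      (hle.mono fun x h => neg_le.1 h)
    rw [key]
    linarith
  · intro x hx y hy
    filter_upwards [husc x hx (-y) (lt_neg.1 hy)] with t ht using lt_neg.1 ht
  · have := hsub (fun x => -φ x) hφ.neg x₀ hx (by rw [h0, neg_neg])
      (hle.mono fun x h => le_neg.1 h)
    rw [key]
    linarith

lemma whitney_eq_neg_mcShane (F : frontier Ω → ℝ) (x : Euc n) :
    whitney Ω F lam x = -mcShane Ω (fun z => -F z) lam x := by
  -- This identity needs neither boundedness nor nonemptiness.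
  rw [whitney, mcShane, iSup, iInf, ← Real.sSup_neg]
  congr 1
  ext y
  simp only [mem_range, Set.mem_neg]
  refine exists_congr fun z => ?_
  constructor <;> intro h <;> linarith

lemma leastLipschitzConst_neg (K : Set (Euc n)) (g : K → ℝ) :
    leastLipschitzConst K (fun z => -g z) = leastLipschitzConst K g := by
  unfold leastLipschitzConst
  congr! 7 with c x y
  rw [← neg_sub', abs_neg]

end Symmetry

/-! ### The least Lipschitz constant -/

section LipschitzConst

variable {n : ℕ} {K : Set (Euc n)} {g : K → ℝ}

lemma leastLipschitzConst_nonneg (K : Set (Euc n)) (g : K → ℝ) : 0 ≤ leastLipschitzConst K g :=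
  Real.sInf_nonneg fun _ hc => hc.1

lemma leastLipschitzConst_le {c : ℝ} (hc : 0 ≤ c)
    (h : ∀ x y : K, |g x - g y| ≤ c * ‖(x : Euc n) - (y : Euc n)‖) :
    leastLipschitzConst K g ≤ c :=
  csInf_le ⟨0, fun _ hc => hc.1⟩ ⟨hc, h⟩

lemma abs_sub_le_leastLipschitzConst (hg : ∃ C : NNReal, LipschitzWith C g) (x y : K) :
    |g x - g y| ≤ leastLipschitzConst K g * ‖(x : Euc n) - (y : Euc n)‖ := by
  rcases eq_or_ne x y with rfl | hxy
  · simp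
  have hpos : 0 < ‖(x : Euc n) - (y : Euc n)‖ :=
    norm_pos_iff.2 (sub_ne_zero.2 fun h => hxy (Subtype.ext h))
  rw [← div_le_iff₀ hpos]
  obtain ⟨C, hC⟩ := hg
  refine le_csInf ⟨C, C.2, fun x y => ?_⟩ fun c hc => (div_le_iff₀ hpos).2 (hc.2 x y)
  have := hC.dist_le_mul x y
  rwa [Real.dist_eq, Subtype.dist_eq, dist_eq_norm] at this

end LipschitzConst

/-! ### McShane's extension: equation and boundary values -/

section McShane

variable {n : ℕ} {Ω : Set (Euc n)} {F : frontier Ω → ℝ} {lam : ℝ}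

lemma isCompact_frontier_of_isBounded (hΩb : Bornology.IsBounded Ω) : IsCompact (frontier Ω) :=
  hΩb.isCompact_closure.of_isClosed_subset isClosed_frontier frontier_subset_closure

/-- In dimension zero the whole space is bounded and has empty frontier, hence `1 ≤ n`. -/
lemma frontier_nonempty_of_isBounded (hn : 1 ≤ n) (hΩb : Bornology.IsBounded Ω)
    (h : Ω.Nonempty) : (frontier Ω).Nonempty := by
  have : Nontrivial (Euc n) := by
    have : Nonempty (Fin n) := ⟨⟨0, hn⟩⟩
    infer_instance
  refine nonempty_frontier_iff.2 ⟨h, ?_⟩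
  rintro rfl
  exact NormedSpace.unbounded_univ ℝ (Euc n) hΩb

lemma exists_mcShane_eq [Nonempty (frontier Ω)] (hΩb : Bornology.IsBounded Ω)
    (hF : Continuous F) (lam : ℝ) (x : Euc n) :
    ∃ z : frontier Ω, mcShane Ω F lam x = F z + lam * ‖x - z‖ ∧
      ∀ w : frontier Ω, mcShane Ω F lam x ≤ F w + lam * ‖x - w‖ := by
  have : CompactSpace (frontier Ω) :=
    isCompact_iff_compactSpace.1 (isCompact_frontier_of_isBounded hΩb)
  have hc : Continuous fun z : frontier Ω => F z + lam * ‖x - z‖ := by fun_prop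
  obtain ⟨z, -, hz⟩ := isCompact_univ.exists_isMinOn univ_nonempty hc.continuousOn
  have hz' : ∀ w : frontier Ω, F z + lam * ‖x - z‖ ≤ F w + lam * ‖x - w‖ :=
    fun w => hz (mem_univ w)
  have heq : mcShane Ω F lam x = F z + lam * ‖x - z‖ :=
    le_antisymm (ciInf_le ⟨_, forall_mem_range.2 hz'⟩ z) (le_ciInf hz')
  exact ⟨z, heq, fun w => heq ▸ hz' w⟩

/-- The cone that is optimal at `x` is a competitor at `y`. -/
lemma mcShane_le_add [Nonempty (frontier Ω)] (hΩb : Bornology.IsBounded Ω) (hF : Continuous F)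
    (hlam : 0 ≤ lam) (x y : Euc n) :
    mcShane Ω F lam y ≤ mcShane Ω F lam x + lam * ‖y - x‖ := by
  obtain ⟨z, hz, -⟩ := exists_mcShane_eq hΩb hF lam x
  obtain ⟨-, -, hw⟩ := exists_mcShane_eq hΩb hF lam y
  have := norm_sub_le_norm_sub_add_norm_sub y x (z : Euc n)
  nlinarith [hw z, mul_le_mul_of_nonneg_left this hlam]

lemma continuous_mcShane [Nonempty (frontier Ω)] (hΩb : Bornology.IsBounded Ω)
    (hF : Continuous F) (hlam : 0 ≤ lam) : Continuous (mcShane Ω F lam) := by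
  refine (LipschitzWith.of_dist_le_mul (K := ⟨lam, hlam⟩) fun x y => ?_).continuous
  have h1 := mcShane_le_add hΩb hF hlam x y
  have h2 := mcShane_le_add hΩb hF hlam y x
  rw [norm_sub_rev] at h1
  rw [Real.dist_eq, dist_eq_norm, abs_le]
  change _ ≤ _ ∧ _ ≤ lam * _
  change -(lam * _) ≤ _ ∧ _
  constructor <;> linarith

/-- McShane's extension is a viscosity solution for every `lam ≥ 0`. -/
lemma isViscositySolution_mcShane [Nonempty (frontier Ω)] (hΩ : IsOpen Ω)
    (hΩb : Bornology.IsBounded Ω) (hF : Continuous F) (hlam : 0 ≤ lam) :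
    IsViscositySolution (jensenMin lam) Ω (mcShane Ω F lam) := by
  have hcont := continuous_mcShane hΩb hF hlam
  refine ⟨⟨hcont.upperSemicontinuous.upperSemicontinuousOn _, fun φ hφ x₀ hx h0 hle => ?_⟩,
    hcont.lowerSemicontinuous.lowerSemicontinuousOn _, fun φ hφ x₀ hx h0 hle => ?_⟩
  · have hd : DifferentiableAt ℝ φ x₀ :=
      (hφ.contDiffAt (hΩ.mem_nhds hx)).differentiableAt (by simp)
    have h1 : ‖gradient (fun x => -φ x) x₀‖ ≤ lam := by
      refine norm_gradient_le_of_eventually_le hd.neg ?_ hlam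
      filter_upwards [hle] with x hx
      have := mcShane_le_add hΩb hF hlam x x₀
      rw [norm_sub_rev] at this
      linarith
    rw [gradient_neg_fun, norm_neg] at h1
    exact min_le_iff.2 (Or.inl (by linarith))
  · obtain ⟨z, hz, -⟩ := exists_mcShane_eq hΩb hF lam x₀
    have hne : x₀ ≠ z := by
      rintro rfl
      exact (hΩ.frontier_eq.subset z.2).2 hx
    obtain ⟨h1, h2⟩ := gradient_infLaplacian_of_le_radial (z := z) (a := lam) (b := 0)
      (hφ.contDiffAt (hΩ.mem_nhds hx)) hne hlam le_rfl (by
        filter_upwards [hle] with x hx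
        obtain ⟨-, -, hw⟩ := exists_mcShane_eq hΩb hF lam x
        linarith [hw z])
    exact le_min (by rw [h1, sub_self]) (by linarith)

lemma mcShane_eq_of_leastLipschitzConst_le (hΩb : Bornology.IsBounded Ω)
    (hF : ∃ C : NNReal, LipschitzWith C F)
    (hlam : leastLipschitzConst (frontier Ω) F ≤ lam) (z : frontier Ω) :
    mcShane Ω F lam z = F z := by
  have : Nonempty (frontier Ω) := ⟨z⟩
  obtain ⟨w, hw, hle⟩ := exists_mcShane_eq hΩb hF.choose_spec.continuous lam (z : Euc n)
  refine le_antisymm (by simpa using hle z) ?_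
  have h1 := (abs_le.1 (abs_sub_le_leastLipschitzConst hF z w)).2
  have h2 := mul_le_mul_of_nonneg_right hlam (norm_nonneg ((z : Euc n) - w))
  linarith

lemma exists_mcShane_ne (hΩb : Bornology.IsBounded Ω) (hF : Continuous F) (hlam : 0 ≤ lam)
    (h : lam < leastLipschitzConst (frontier Ω) F) :
    ∃ z : frontier Ω, mcShane Ω F lam z ≠ F z := by
  by_contra! hall
  refine h.not_ge (leastLipschitzConst_le hlam fun x y => ?_)
  have : Nonempty (frontier Ω) := ⟨x⟩
  have h1 := mcShane_le_add hΩb hF hlam (x : Euc n) y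
  have h2 := mcShane_le_add hΩb hF hlam (y : Euc n) x
  rw [norm_sub_rev, hall, hall] at h1
  rw [hall, hall] at h2
  rw [abs_le]
  constructor <;> linarith

end McShane

/-! ### Comparison with cones -/

section Comparison

variable {n : ℕ} {Ω : Set (Euc n)} {lam : ℝ} {v : Euc n → ℝ}

/-- Comparison with cones from above. -/
lemma IsViscositySubsolution.le_cone (hΩ : IsOpen Ω) (hΩb : Bornology.IsBounded Ω)
    (hlam : 0 ≤ lam) (hv : ContinuousOn v (closure Ω))
    (hsub : IsViscositySubsolution (jensenMin lam) Ω v) {z : Euc n} (hz : z ∉ Ω) {c : ℝ}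
    (hbd : ∀ x ∈ frontier Ω, v x ≤ c + lam * ‖x - z‖) {x : Euc n} (hx : x ∈ closure Ω) :
    v x ≤ c + lam * ‖x - z‖ := by
  by_contra! hlt
  set γ := v x - (c + lam * ‖x - z‖) with hγ
  have hγ0 : 0 < γ := by linarith
  obtain ⟨R, hR0, hR⟩ : ∃ R : ℝ, 0 < R ∧ ∀ y ∈ closure Ω, ‖y - z‖ ≤ R := by
    obtain ⟨R, hR0, hR⟩ := hΩb.closure.subset_closedBall_lt 0 z
    exact ⟨R, hR0, fun y hy => by simpa [dist_eq_norm] using hR hy⟩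
  set ε := γ / (2 * R) with hε
  have hε0 : 0 < ε := by positivity
  have hεR : ε * R = γ / 2 := by rw [hε]; field_simp
  set δ := ε / (4 * R) with hδ
  have hδ0 : 0 < δ := by positivity
  have hδR : δ * R = ε / 4 := by rw [hδ]; field_simp
  -- Up to radius `R` the radial slope is at least `lam + ε / 2` and the second radial derivative is
  -- `-2 * δ`, so both entries of the minimum are positive. The choice of `ε` costs at most `γ / 2`
  -- at `x`, which keeps the maximum of `v - ψ` off the boundary.
  set ψ : Euc n → ℝ := fun y => (lam + ε) * ‖y - z‖ - δ * ‖y - z‖ ^ 2 with hψ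
  have hψge : ∀ y ∈ closure Ω, lam * ‖y - z‖ ≤ ψ y := by
    intro y hy
    have h1 := mul_le_mul_of_nonneg_left (hR y hy) hδ0.le
    have h2 := norm_nonneg (y - z)
    simp only [hψ]
    nlinarith
  have hψle : ψ x ≤ lam * ‖x - z‖ + ε * R := by
    have h1 := mul_le_mul_of_nonneg_left (hR x hx) hε0.le
    simp only [hψ]
    nlinarith [sq_nonneg ‖x - z‖]
  have hψc : Continuous ψ := by fun_prop
  obtain ⟨x₀, hx₀, hmax⟩ := hΩb.isCompact_closure.exists_isMaxOn ⟨x, hx⟩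
    (hv.sub hψc.continuousOn)
  have hmax' : ∀ y ∈ closure Ω, v y - ψ y ≤ v x₀ - ψ x₀ := fun y hy => hmax hy
  have hx₀Ω : x₀ ∈ Ω := by
    by_contra hnot
    have hfr : x₀ ∈ frontier Ω := by rw [hΩ.frontier_eq]; exact ⟨hx₀, hnot⟩
    linarith [hbd x₀ hfr, hψge x₀ hx₀, hmax' x hx]
  have hsmooth : ContDiffOn ℝ 2 (fun y => v x₀ - ψ x₀ + ψ y) Ω := by
    have hn : ContDiffOn ℝ 2 (fun y : Euc n => ‖y - z‖) Ω :=
      (contDiffOn_id.sub contDiffOn_const).norm ℝ fun y hy h0 => hz (sub_eq_zero.1 h0 ▸ hy)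
    exact contDiffOn_const.add ((contDiffOn_const.mul hn).sub (contDiffOn_const.mul (hn.pow 2)))
  have hG := hsub.2 _ hsmooth x₀ hx₀Ω (by simp) (by
    filter_upwards [hΩ.mem_nhds hx₀Ω] with y hy
    linarith [hmax' y (subset_closure hy)])
  have hslope : lam < lam + ε - 2 * δ * ‖x₀ - z‖ := by
    have h1 := mul_le_mul_of_nonneg_left (hR x₀ hx₀) hδ0.le
    linarith
  obtain ⟨h1, h2⟩ := gradient_infLaplacian_of_le_radial (z := z)
    (a := lam + ε - 2 * δ * ‖x₀ - z‖) (b := -δ) (hsmooth.contDiffAt (hΩ.mem_nhds hx₀Ω))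
    (fun h => hz (h ▸ hx₀Ω)) (by linarith) (by linarith)
    (.of_forall fun y => le_of_eq (by simp only [hψ]; ring))
  refine hG.not_gt (lt_min (by rw [h1]; linarith) ?_)
  have : 0 < δ * (lam + ε - 2 * δ * ‖x₀ - z‖) ^ 2 := mul_pos hδ0 (pow_pos (by linarith) 2)
  linarith

/-- Only the `-Δ_∞` entry of the minimum is used, so `mu` is free. -/
lemma IsViscositySupersolution.neg_jensenMin {mu : ℝ}
    (h : IsViscositySupersolution (jensenMin lam) Ω v) :
    IsViscositySubsolution (jensenMin mu) Ω (fun x => -v x) := by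
  refine ⟨fun x hx y hy => ?_, fun φ hφ x₀ hx h0 hle => ?_⟩
  · filter_upwards [h.1 x hx (-y) (neg_lt.1 hy)] with t ht using neg_lt.1 ht
  · have h1 := h.2 (fun x => -φ x) hφ.neg x₀ hx (by rw [h0, neg_neg])
      (hle.mono fun x h => neg_le.1 h)
    have h2 := h1.trans (min_le_right _ _)
    rw [infLaplacian_neg_fun, neg_neg] at h2
    exact min_le_iff.2 (Or.inr (by linarith))

lemma sqrt_sq_add_sq_le (A B ε : ℝ) :
    √(B ^ 2 + ε ^ 2) ≤ √(A ^ 2 + ε ^ 2) + |B - A| := by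
  have h0 := Real.sqrt_nonneg (A ^ 2 + ε ^ 2)
  have h1 : |A| ≤ √(A ^ 2 + ε ^ 2) := Real.abs_le_sqrt (by nlinarith [sq_nonneg ε])
  rw [Real.sqrt_le_left (by positivity)]
  have h2 := Real.sq_sqrt (show 0 ≤ A ^ 2 + ε ^ 2 by positivity)
  have h3 : A * (B - A) ≤ √(A ^ 2 + ε ^ 2) * |B - A| :=
    (le_abs_self _).trans (by rw [abs_mul]; gcongr)
  nlinarith [sq_abs (B - A)]

/-- A supersolution of `|∇v| ≥ lam` lies, up to a small error, above a cone of slope almost `lam`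
with vertex on the boundary. -/
lemma IsViscositySupersolution.exists_cone_le (hΩ : IsOpen Ω) (hΩb : Bornology.IsBounded Ω)
    (hv : ContinuousOn v (closure Ω)) (hsup : IsViscositySupersolution (jensenMin lam) Ω v)
    {η : ℝ} (hη : 0 < η) (hηlam : η ≤ lam) {x : Euc n} (hx : x ∈ closure Ω) :
    ∃ z ∈ frontier Ω, v z + (lam - η) * ‖x - z‖ ≤ v x + (lam - η) * η := by
  have hmu : 0 ≤ lam - η := by linarith
  -- The vertex `x` may lie in Ω, where the cone is not `C²`; the square root smooths it without
  -- increasing the slope.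
  set ψ : Euc n → ℝ := fun y => (lam - η) * √(‖y - x‖ ^ 2 + η ^ 2) with hψ
  have hψs : ContDiff ℝ 2 ψ :=
    contDiff_const.mul (((contDiff_id.sub contDiff_const).norm_sq ℝ).add contDiff_const |>.sqrt
      fun y => by positivity)
  obtain ⟨x₀, hx₀, hmin⟩ := hΩb.isCompact_closure.exists_isMinOn ⟨x, hx⟩
    (hv.add hψs.continuous.continuousOn)
  have hmin' : ∀ y ∈ closure Ω, v x₀ + ψ x₀ ≤ v y + ψ y := fun y hy => hmin hy
  have hx₀Ω : x₀ ∉ Ω := by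
    intro hx₀Ω
    have hs : ContDiff ℝ 2 fun y => v x₀ + ψ x₀ - ψ y := contDiff_const.sub hψs
    have hG := hsup.2 _ hs.contDiffOn x₀ hx₀Ω (by simp) (by
      filter_upwards [hΩ.mem_nhds hx₀Ω] with y hy
      linarith [hmin' y (subset_closure hy)])
    have h1 := hG.trans (min_le_left _ _)
    have h2 : ‖gradient (fun y => v x₀ + ψ x₀ - ψ y) x₀‖ ≤ lam - η := by
      refine norm_gradient_le_of_eventually_le (hs.differentiable (by simp) x₀)
        (.of_forall fun y => ?_) hmu
      have h3 := sqrt_sq_add_sq_le ‖y - x‖ ‖x₀ - x‖ η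
      have h4 : |‖x₀ - x‖ - ‖y - x‖| ≤ ‖y - x₀‖ := by
        have := abs_norm_sub_norm_le (x₀ - x) (y - x)
        rwa [sub_sub_sub_cancel_right, norm_sub_rev x₀ y] at this
      have h5 := mul_le_mul_of_nonneg_left (h3.trans (add_le_add_right h4 _)) hmu
      simp only [hψ]
      linarith
    linarith
  refine ⟨x₀, by rw [hΩ.frontier_eq]; exact ⟨hx₀, hx₀Ω⟩, ?_⟩
  have h1 : ‖x - x₀‖ ≤ √(‖x₀ - x‖ ^ 2 + η ^ 2) := by
    rw [norm_sub_rev]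
    exact Real.le_sqrt_of_sq_le (by nlinarith [sq_nonneg η])
  have h2 : ψ x = (lam - η) * η := by simp [hψ, Real.sqrt_sq hη.le]
  have h3 := mul_le_mul_of_nonneg_left h1 hmu
  have h4 := hmin' x hx
  rw [h2] at h4
  exact (add_le_add_right h3 _).trans h4

end Comparison

/-! ### Uniqueness for the Dirichlet problem -/

section Dirichlet

variable {n : ℕ} {Ω : Set (Euc n)} {F : frontier Ω → ℝ} {lam : ℝ} {v : Euc n → ℝ}

lemma IsDirichletSolution.le_mcShane (hΩ : IsOpen Ω) (hΩb : Bornology.IsBounded Ω)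
    [Nonempty (frontier Ω)] (hF : ∃ C : NNReal, LipschitzWith C F)
    (hlam : leastLipschitzConst (frontier Ω) F ≤ lam)
    (hv : IsDirichletSolution (jensenMin lam) Ω F v) {x : Euc n} (hx : x ∈ closure Ω) :
    v x ≤ mcShane Ω F lam x := by
  refine le_ciInf fun z => hv.2.1.1.le_cone hΩ hΩb
    ((leastLipschitzConst_nonneg _ _).trans hlam) hv.1
    (hΩ.frontier_eq.subset z.2).2 (fun y hy => ?_) hx
  have h1 := (abs_le.1 (abs_sub_le_leastLipschitzConst hF ⟨y, hy⟩ z)).2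
  have h2 := mul_le_mul_of_nonneg_right hlam (norm_nonneg (y - (z : Euc n)))
  have h3 := hv.2.2 ⟨y, hy⟩
  simp only at h1 h3
  linarith

lemma IsDirichletSolution.mcShane_le (hΩ : IsOpen Ω) (hΩb : Bornology.IsBounded Ω)
    [Nonempty (frontier Ω)] (hF : ∃ C : NNReal, LipschitzWith C F)
    (hlam : leastLipschitzConst (frontier Ω) F ≤ lam)
    (hv : IsDirichletSolution (jensenMin lam) Ω F v) {x : Euc n} (hx : x ∈ closure Ω) :
    mcShane Ω F lam x ≤ v x := by
  obtain ⟨-, -, hle⟩ := exists_mcShane_eq hΩb hF.choose_spec.continuous lam x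
  have hlam0 := (leastLipschitzConst_nonneg _ _).trans hlam
  rcases hlam0.eq_or_lt with h0 | hpos
  -- With `lam = 0` there is no slope to give up. But `F` is then constant, and `-v` is compared
  -- with a constant.
  · subst h0
    obtain ⟨z⟩ := ‹Nonempty (frontier Ω)›
    have hz : (z : Euc n) ∉ Ω := (hΩ.frontier_eq.subset z.2).2
    have h1 := hv.2.1.2.neg_jensenMin.le_cone (lam := 0) (c := -F z) hΩ hΩb le_rfl hv.1.neg hz
      (fun y hy => by
        have h1 := (abs_le.1 (abs_sub_le_leastLipschitzConst hF ⟨y, hy⟩ z)).1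
        have h2 := mul_le_mul_of_nonneg_right hlam (norm_nonneg (y - (z : Euc n)))
        have h3 := hv.2.2 ⟨y, hy⟩
        simp only [Pi.neg_apply] at h1 h3 ⊢
        linarith) hx
    simp only [Pi.neg_apply] at h1
    linarith [hle z]
  · obtain ⟨R, hR0, hR⟩ : ∃ R : ℝ, 0 < R ∧ ∀ y ∈ closure Ω, ‖x - y‖ ≤ R := by
      obtain ⟨R, hR0, hR⟩ := hΩb.closure.subset_closedBall_lt 0 x
      exact ⟨R, hR0, fun y hy => by simpa [dist_eq_norm, norm_sub_rev] using hR hy⟩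
    by_contra! hlt
    set γ := mcShane Ω F lam x - v x with hγ
    have hγ0 : 0 < γ := by linarith
    -- The total error is at most `η * (R + lam) ≤ γ / 2`; the bound `η ≤ lam` keeps the slope
    -- nonnegative.
    have hη0 : 0 < min lam (γ / (2 * (R + lam))) := lt_min hpos (by positivity)
    have hη := min_le_right lam (γ / (2 * (R + lam)))
    have hηlam := min_le_left lam (γ / (2 * (R + lam)))
    generalize min lam (γ / (2 * (R + lam))) = η at hη0 hη hηlam
    rw [le_div_iff₀ (by positivity)] at hη
    obtain ⟨z, hz, hzle⟩ := hv.2.1.2.exists_cone_le hΩ hΩb hv.1 hη0 hηlam hx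
    have h1 := hle ⟨z, hz⟩
    have h2 := hv.2.2 ⟨z, hz⟩
    have h3 := mul_le_mul_of_nonneg_left (hR z (frontier_subset_closure hz)) hη0.le
    simp only at h1 h2
    nlinarith

lemma isUniqueDirichletSolution_mcShane (hn : 1 ≤ n) (hΩ : IsOpen Ω)
    (hΩb : Bornology.IsBounded Ω) (hF : ∃ C : NNReal, LipschitzWith C F)
    (hlam : leastLipschitzConst (frontier Ω) F ≤ lam) :
    IsUniqueDirichletSolution (jensenMin lam) Ω F (mcShane Ω F lam) := by
  rcases Ω.eq_empty_or_nonempty with rfl | hne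
  · have hfr (z : frontier (∅ : Set (Euc n))) : False := by simpa using z.2
    refine ⟨⟨by simp, ⟨⟨?_, ?_⟩, ?_, ?_⟩, fun z => (hfr z).elim⟩, fun v _ x hx => ?_⟩
    · exact fun x hx => hx.elim
    · exact fun φ _ x hx => hx.elim
    · exact fun x hx => hx.elim
    · exact fun φ _ x hx => hx.elim
    · simp at hx
  have : Nonempty (frontier Ω) := (frontier_nonempty_of_isBounded hn hΩb hne).to_subtype
  have hc := hF.choose_spec.continuous
  have hlam0 := (leastLipschitzConst_nonneg _ _).trans hlam
  exact ⟨⟨(continuous_mcShane hΩb hc hlam0).continuousOn,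
    isViscositySolution_mcShane hΩ hΩb hc hlam0,
    mcShane_eq_of_leastLipschitzConst_le hΩb hF hlam⟩,
    fun v hv x hx => le_antisymm (hv.le_mcShane hΩ hΩb hF hlam hx)
      (hv.mcShane_le hΩ hΩb hF hlam hx)⟩

lemma whitney_eq_neg_mcShane_fun :
    mcShane Ω (fun z => -F z) lam = fun x => -whitney Ω F lam x := by
  ext x
  rw [whitney_eq_neg_mcShane, neg_neg]

lemma isUniqueDirichletSolution_whitney (hn : 1 ≤ n) (hΩ : IsOpen Ω)
    (hΩb : Bornology.IsBounded Ω) (hF : ∃ C : NNReal, LipschitzWith C F)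
    (hlam : leastLipschitzConst (frontier Ω) F ≤ lam) :
    IsUniqueDirichletSolution (jensenMax lam) Ω F (whitney Ω F lam) := by
  have hF' : ∃ C : NNReal, LipschitzWith C fun z => -F z := hF.imp fun C hC => hC.neg
  have h := isUniqueDirichletSolution_mcShane hn hΩ hΩb hF'
    ((leastLipschitzConst_neg _ _).trans_le hlam)
  rw [whitney_eq_neg_mcShane_fun] at h
  obtain ⟨⟨h1, h2, h3⟩, h4⟩ := h
  refine ⟨⟨h1.neg.congr fun x _ => (neg_neg _).symm, h2.jensenMax_of_neg, fun z => neg_inj.1 (h3 z)⟩,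
    fun v hv x hx => ?_⟩
  exact neg_inj.1 (h4 (fun x => -v x)
    ⟨hv.1.neg, hv.2.1.jensenMin_neg, fun z => congrArg Neg.neg (hv.2.2 z)⟩ hx)

end Dirichlet

theorem theorem1 {n : ℕ} (hn : 1 ≤ n) (Ω : Set (Euc n)) (hΩ : IsOpen Ω)
    (hΩb : Bornology.IsBounded Ω) (F : frontier Ω → ℝ)
    (hF : ∃ K : NNReal, LipschitzWith K F) :
    (∀ lam : ℝ, leastLipschitzConst (frontier Ω) F ≤ lam →
      IsUniqueDirichletSolution (jensenMin lam) Ω F (mcShane Ω F lam) ∧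
      IsUniqueDirichletSolution (jensenMax lam) Ω F (whitney Ω F lam)) ∧
    (∀ lam : ℝ, 0 ≤ lam → lam < leastLipschitzConst (frontier Ω) F →
      IsViscositySolution (jensenMin lam) Ω (mcShane Ω F lam) ∧
      IsViscositySolution (jensenMax lam) Ω (whitney Ω F lam) ∧
      (∃ z : frontier Ω, mcShane Ω F lam z ≠ F z) ∧
      (∃ z : frontier Ω, whitney Ω F lam z ≠ F z)) := by
  have hc : Continuous F := hF.choose_spec.continuous
  refine ⟨fun lam hlam => ⟨isUniqueDirichletSolution_mcShane hn hΩ hΩb hF hlam,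
    isUniqueDirichletSolution_whitney hn hΩ hΩb hF hlam⟩, fun lam hlam hlt => ?_⟩
  obtain ⟨z, hz⟩ := exists_mcShane_ne hΩb hc hlam hlt
  have : Nonempty (frontier Ω) := ⟨z⟩
  have hc' : Continuous fun z => -F z := hc.neg
  have h := isViscositySolution_mcShane hΩ hΩb hc' hlam
  rw [whitney_eq_neg_mcShane_fun] at h
  obtain ⟨w, hw⟩ := exists_mcShane_ne hΩb hc' hlam
    (hlt.trans_eq (leastLipschitzConst_neg _ _).symm)
  refine ⟨isViscositySolution_mcShane hΩ hΩb hc hlam, h.jensenMax_of_neg, ⟨z, hz⟩, w, fun h => ?_⟩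
  rw [whitney_eq_neg_mcShane_fun] at hw
  exact hw (congrArg Neg.neg h)
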